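/- Let $1<p<\infty$ and $\gamma>0>\eta$. Let $b\colon X\times X\to\{0,1\}$ be the edge weight of a connected, locally finite (unweighted) tree on a countable vertex set $X$ with root $o\in X$, let $d$ be the combinatorial distance, and $S_n=\{x\in X: d(x,o)=n\}$. Assume the tree is spherically symmetric with branching numbers $k\colon\{0,1,2,\dots\}\to\{1,2,3,\dots\}$, i.e. every $x\in S_n$ has exactly $k(n)$ neighbours in $S_{n+1}$ (and, if $n\ge 1$, exactly one neighbour in $S_{n-1}$). Let $m\colon X\to(0,\infty)$ be spherically symmetric, i.e. $m(x)$ depends only on $d(x,o)$, and write $m(n)$ for its value on $S_n$. Assume that $k$ is (weakly) increasing, $m$ is (weakly) decreasing in $n$, and that $k(n)\asymp n^\gamma$ and $m(n)\asymp n^\eta$ for $n\ge1$, meaning that the two sides bound each other up to positive constants, uniformly in $n\geq 1$. For $f\colon X\to\mathbb R$ put $$\mathcal Q(f)=\frac1p\sum_{x,y\in X}b(x,y)|f(x)-f(y)|^p,\qquad \|f\|_p^p=\sum_{x\in X}|f(x)|^pm(x),\qquad A|f|^p(n)=\sum_{x\in S_n}|f(x)|^p .$$ Let $\mathcal D=\{f\colon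 X\to\mathbb R:\mathcal Q(f)<\infty\}$, let $H^{1,p}(X,m)=\{f\in\mathcal D:\|f\|_p<\infty\}$ with norm $(\mathcal Q(f)+\|f\|_p^p)^{1/p}$, and let $H^{1,p}_0(X,m)$ be the closure in $H^{1,p}(X,m)$ of the finitely supported functions. 1. If $\gamma\le\eta+p$, then $H^{1,p}(X,m)=H^{1,p}_0(X,m)$. 2. If $\gamma>\eta+p$, then there exists $C>0$ such that for all $f\in H_0^{1,p}(X,m)$ $$C\sum_{n=1}^\infty A|f|^p(n)\,n^{\gamma-p}\le\mathcal Q(f)+\sum_{n=1}^\infty A|f|^p(n)\,n^\eta+|f(o)|^pm(o).$$ Moreover, a function $f\colon X\to\mathbb R$ belongs to $H^{1,p}_0(X,m)$ if and only if $f\in\mathcal D$ and $\sum_{n=1}^\infty A|f|^p(n)\,n^{\gamma-p}<\infty$. -/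

import Mathlib

open scoped ENNReal

noncomputable section

/-- A weighted graph on a set `X`: a symmetric, nonnegative function with zero diagonal
and finite vertex degrees `∑_y b(x,y)`. -/
structure WeightedGraph (X : Type*) where
  b : X → X → ℝ
  nonneg : ∀ x y, 0 ≤ b x y
  symm : ∀ x y, b x y = b y x
  diag : ∀ x, b x x = 0
  summable : ∀ x, Summable (b x)

namespace WeightedGraph

/-- The relation `x ∼ y`, that is `b(x,y) > 0`. Paths, connectedness, trees and the
combinatorial distance of the weighted graph are those of this simple graph. -/
def toSimpleGraph {X : Type*} (G : WeightedGraph X) : SimpleGraph X where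
  Adj x y := 0 < G.b x y
  symm := ⟨fun x y h => by rw [G.symm y x]; exact h⟩
  loopless := ⟨fun x h => by rw [G.diag x] at h; exact lt_irrefl _ h⟩

/-- The combinatorial sphere `S_n` of radius `n` around `o`. -/
def sphere {X : Type*} (G : WeightedGraph X) (o : X) (n : ℕ) : Set X :=
  {x | G.toSimpleGraph.dist o x = n}

/-- The outgoing degree `deg_+(x)`: the sum of `b(x,y)` over `y ∈ S_{d(x,o)+1}`. -/
def outDegree {X : Type*} (G : WeightedGraph X) (o x : X) : ℝ :=
  ∑' y : {y : X // G.toSimpleGraph.dist o y = G.toSimpleGraph.dist o x + 1}, G.b x y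

/-- The incoming degree `deg_-(x)`: the sum of `b(x,y)` over `y ∈ S_{d(x,o)-1}`. The sphere is
empty for `x = o`, so that `deg_-(o) = 0`. -/
def inDegree {X : Type*} (G : WeightedGraph X) (o x : X) : ℝ :=
  ∑' y : {y : X // G.toSimpleGraph.dist o y + 1 = G.toSimpleGraph.dist o x}, G.b x y

/-- `G` is a spherically symmetric tree with root `o` and branching numbers
`k : ℕ₀ → {1, 2, …}`. -/
structure IsSphericallySymmetricTree {X : Type*} (G : WeightedGraph X) (o : X) (k : ℕ → ℕ) :
    Prop where
  isTree : G.toSimpleGraph.IsTree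
  weight : ∀ x y, G.b x y = 0 ∨ G.b x y = 1
  inDegree_eq : ∀ x, x ≠ o → G.inDegree o x = 1
  outDegree_eq : ∀ x, G.outDegree o x = k (G.toSimpleGraph.dist o x)
  branching_pos : ∀ n, 1 ≤ k n

/-- The `p`-energy `𝒬(f) = (1/p) ∑_{x,y} b(x,y) |f(x) - f(y)|^p ∈ [0,∞]`. -/
def energy {X : Type*} (G : WeightedGraph X) (p : ℝ) (f : X → ℝ) : ℝ≥0∞ :=
  ENNReal.ofReal (1 / p) * ∑' x : X, ∑' y : X, ENNReal.ofReal (G.b x y * |f x - f y| ^ p)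

/-- The space `𝒟` of functions of finite `p`-energy. -/
def finiteEnergy {X : Type*} (G : WeightedGraph X) (p : ℝ) : Set (X → ℝ) :=
  {f | ∑' x : X, ∑' y : X, ENNReal.ofReal (G.b x y * |f x - f y| ^ p) < ∞}

/-- `‖f‖_p^p = ∑_x |f(x)|^p m(x) ∈ [0,∞]`. -/
def lpMass {X : Type*} (m : X → ℝ) (p : ℝ) (f : X → ℝ) : ℝ≥0∞ :=
  ∑' x : X, ENNReal.ofReal (|f x| ^ p * m x)

/-- The Sobolev space `H^{1,p}(X,m) = 𝒟 ∩ ℓ^p(X,m)`. -/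
def sobolev {X : Type*} (G : WeightedGraph X) (m : X → ℝ) (p : ℝ) : Set (X → ℝ) :=
  {f | f ∈ G.finiteEnergy p ∧ lpMass m p f < ∞}

/-- The Sobolev norm `(𝒬(f) + ‖f‖_p^p)^{1/p}`, which is finite on `H^{1,p}(X,m)`. -/
def sobolevNorm {X : Type*} (G : WeightedGraph X) (m : X → ℝ) (p : ℝ) (f : X → ℝ) : ℝ≥0∞ :=
  (G.energy p f + lpMass m p f) ^ (1 / p)

/-- `H_0^{1,p}(X,m)`: the closure, in the Sobolev norm, of the finitely supported functions
in `H^{1,p}(X,m)`. -/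
def sobolevZero {X : Type*} (G : WeightedGraph X) (m : X → ℝ) (p : ℝ) : Set (X → ℝ) :=
  {f | f ∈ G.sobolev m p ∧
    ∀ ε : ℝ, 0 < ε → ∃ φ : X → ℝ, (Function.support φ).Finite ∧
      G.sobolevNorm m p (f - φ) < ENNReal.ofReal ε}

/-- `A|f|^p(n) = ∑_{x ∈ S_n} |f(x)|^p`. -/
def sphereSum {X : Type*} (G : WeightedGraph X) (o : X) (p : ℝ) (f : X → ℝ) (n : ℕ) : ℝ≥0∞ :=
  ∑' x : G.sphere o n, ENNReal.ofReal (|f x| ^ p)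

/-- `∑_{n ≥ 1} A|f|^p(n) n^s ∈ [0,∞]`. -/
def radialSum {X : Type*} (G : WeightedGraph X) (o : X) (p s : ℝ) (f : X → ℝ) : ℝ≥0∞ :=
  ∑' n : ℕ, G.sphereSum o p f (n + 1) * ENNReal.ofReal (((n + 1 : ℕ) : ℝ) ^ s)

end WeightedGraph

/-- `f(n) ≍ g(n)` for `n ≥ K`. -/
def AsympFrom (K : ℕ) (f g : ℕ → ℝ) : Prop :=
  ∃ C D : ℝ, 0 < C ∧ 0 < D ∧ ∀ n : ℕ, K ≤ n → C * f n ≤ g n ∧ g n ≤ D * f n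

end

/-!
The branching numbers `k` tend to infinity, so on a tree the energy controls a weighted `ℓ^p`-sum
directly. For an edge from `x` to a child `y`,
`|φ(x)|^p ≤ 2^(p-1) (|φ(x) - φ(y)|^p + |φ(y)|^p)`. Summing over the `k` children of every `x`, and
using that every `y` has at most one parent, gives
`∑ |φ(x)|^p k(|x|) ≤ 2^(p-1) (p 𝒬(φ) + ∑ |φ(x)|^p)` (`tsum_mul_branching_le`). For finitely
supported `φ` both sides are finite. Where `k ≥ 2^p` the last sum is absorbed into the left-hand
side, and on the remaining finite ball it is bounded by the `ℓ^p(X,m)`-norm. This is a Hardy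
inequality with weight `k(n) ≍ n^γ`, stronger than the required `n^(γ-p)`
(`hardy_of_finite_support`); it extends to `H_0^{1,p}` by approximation
(`hardy_of_mem_sobolevZero`).

Conversely, suppose that `f` lies in `H^{1,p}` and `∑ A|f|^p(n) n^(γ-p)` is finite. Let `ψ` be the
radial function that rises linearly from `0` to `1` between the radii `N` and `2N`. Then
`f (1 - ψ)` is finitely supported, and `𝒬(f ψ)` is bounded by a tail of the energy of `f` plus a
constant times `∑_{n ≥ N} A|f|^p(n) k(n) n^(-p)`, because the slope `1/N` of `ψ` is at most `2/n`
where `ψ` is not constant. All these tails tend to zero, so `f` is in `H_0^{1,p}`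
(`mem_sobolevZero_of_radialSum`).

If `γ ≤ η + p`, then `n^(γ-p) ≤ n^η`, and the second paragraph applies to every `f` in `H^{1,p}`.
If `γ > η + p`, then `n^η ≤ n^(γ-p)`, so the finiteness of `∑ A|f|^p(n) n^(γ-p)` implies that of
the `ℓ^p(X,m)`-norm, and the two paragraphs give the two directions of the characterization.

All sums are taken in `[0,∞]`, so that no summability has to be tracked.
-/

namespace WeightedGraph

open Filter Topology

/-! ### Energy, mass and radial sums as sums over vertices -/

section Basic

variable {X : Type*}

lemma ofReal_abs_add_rpow_le {p : ℝ} (hp : 1 ≤ p) (a b : ℝ) :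
    ENNReal.ofReal (|a + b| ^ p) ≤
      (2 : ℝ≥0∞) ^ (p - 1) * (ENNReal.ofReal (|a| ^ p) + ENNReal.ofReal (|b| ^ p)) := by
  have hp0 : 0 ≤ p := by linarith
  rw [← ENNReal.ofReal_rpow_of_nonneg (abs_nonneg _) hp0,
    ← ENNReal.ofReal_rpow_of_nonneg (abs_nonneg _) hp0,
    ← ENNReal.ofReal_rpow_of_nonneg (abs_nonneg _) hp0]
  refine le_trans ?_ (ENNReal.rpow_add_le_mul_rpow_add_rpow _ _ hp)
  rw [← ENNReal.ofReal_add (abs_nonneg _) (abs_nonneg _)]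
  exact ENNReal.rpow_le_rpow (ENNReal.ofReal_le_ofReal (abs_add_le a b)) hp0

lemma two_rpow_ne_top (s : ℝ) : (2 : ℝ≥0∞) ^ s ≠ ∞ :=
  ENNReal.rpow_ne_top_of_ne_zero (by norm_num) (by norm_num)

lemma tsum_ite_eq_tsum_subtype {ι : Type*} (P : ι → Prop) [DecidablePred P] (a : ι → ℝ≥0∞) :
    (∑' i, if P i then a i else 0) = ∑' i : {i // P i}, a i := by
  refine Eq.trans (tsum_congr fun i => ?_) (tsum_subtype {i | P i} a).symm
  simp [Set.indicator_apply]

/-- The sum of `b(x,y)|f(x)-f(y)|^p` over ordered pairs, that is `p` times the energy. -/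
noncomputable def pairSum (G : WeightedGraph X) (p : ℝ) (f : X → ℝ) : ℝ≥0∞ :=
  ∑' x : X, ∑' y : X, ENNReal.ofReal (G.b x y * |f x - f y| ^ p)

lemma pairSum_eq_tsum (G : WeightedGraph X) (p : ℝ) (f : X → ℝ) :
    G.pairSum p f =
      ∑' x : X, ∑' y : X, ENNReal.ofReal (G.b x y) * ENNReal.ofReal (|f x - f y| ^ p) := by
  simp only [pairSum, ENNReal.ofReal_mul (G.nonneg _ _)]

lemma pairSum_eq_mul_energy (G : WeightedGraph X) {p : ℝ} (hp : 0 < p) (f : X → ℝ) :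
    G.pairSum p f = ENNReal.ofReal p * G.energy p f := by
  rw [energy, ← mul_assoc, ← ENNReal.ofReal_mul hp.le, mul_one_div_cancel hp.ne',
    ENNReal.ofReal_one, one_mul, pairSum]

lemma pairSum_add_le (G : WeightedGraph X) {p : ℝ} (hp : 1 ≤ p) (f g : X → ℝ) :
    G.pairSum p (f + g) ≤ (2 : ℝ≥0∞) ^ (p - 1) * (G.pairSum p f + G.pairSum p g) := by
  simp only [pairSum_eq_tsum, ← ENNReal.tsum_add, ← ENNReal.tsum_mul_left]
  refine ENNReal.tsum_le_tsum fun x => ENNReal.tsum_le_tsum fun y => ?_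
  have h := ofReal_abs_add_rpow_le hp (f x - f y) (g x - g y)
  rw [← mul_add, mul_left_comm]
  refine mul_le_mul_right (le_trans (le_of_eq ?_) h) _
  simp only [Pi.add_apply]
  ring_nf

lemma lpMass_eq_tsum (m : X → ℝ) (p : ℝ) (f : X → ℝ) :
    lpMass m p f = ∑' x : X, ENNReal.ofReal (|f x| ^ p) * ENNReal.ofReal (m x) := by
  simp only [lpMass, ENNReal.ofReal_mul (Real.rpow_nonneg (abs_nonneg _) _)]

lemma lpMass_add_le (m : X → ℝ) {p : ℝ} (hp : 1 ≤ p) (f g : X → ℝ) :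
    lpMass m p (f + g) ≤ (2 : ℝ≥0∞) ^ (p - 1) * (lpMass m p f + lpMass m p g) := by
  simp only [lpMass_eq_tsum, ← ENNReal.tsum_add, ← ENNReal.tsum_mul_left]
  refine ENNReal.tsum_le_tsum fun x => ?_
  rw [← add_mul, ← mul_assoc]
  exact mul_le_mul_left (ofReal_abs_add_rpow_le hp _ _) _

lemma radialSum_eq_tsum (G : WeightedGraph X) (o : X) (p s : ℝ) (f : X → ℝ) :
    G.radialSum o p s f = ∑' x : X, if G.toSimpleGraph.dist o x = 0 then 0 else
      ENNReal.ofReal (|f x| ^ p) * ENNReal.ofReal ((G.toSimpleGraph.dist o x : ℝ) ^ s) := by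
  rw [← ENNReal.tsum_fiberwise _ (G.toSimpleGraph.dist o), tsum_eq_zero_add' ENNReal.summable]
  have h0 : ∑' x : ((G.toSimpleGraph.dist o) ⁻¹' {0} : Set X),
      (if G.toSimpleGraph.dist o x = 0 then 0 else ENNReal.ofReal (|f x| ^ p) *
        ENNReal.ofReal ((G.toSimpleGraph.dist o x : ℝ) ^ s)) = 0 := by
    rw [ENNReal.tsum_eq_zero]
    rintro ⟨x, hx⟩
    exact if_pos hx
  rw [h0, zero_add, radialSum]
  refine tsum_congr fun n => ?_
  rw [sphereSum, ← ENNReal.tsum_mul_right]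
  refine tsum_congr fun x => ?_
  have hx : G.toSimpleGraph.dist o x = n + 1 := x.2
  rw [if_neg (by omega), hx]

/-- Tails of a convergent series, taken along an arbitrary index function, tend to zero. -/
lemma tendsto_tsum_tail {ι : Type*} {a : ι → ℝ≥0∞} (ha : ∑' i, a i ≠ ∞) (h : ι → ℕ) :
    Tendsto (fun N : ℕ => ∑' i, if N ≤ h i then a i else 0) atTop (𝓝 0) := by
  rw [ENNReal.tendsto_nhds_zero]
  intro ε hε
  obtain ⟨s, hs⟩ := ((ENNReal.tendsto_nhds_zero.1
    (ENNReal.tendsto_tsum_compl_atTop_zero ha)) ε hε).exists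
  filter_upwards [eventually_gt_atTop (s.sup h)] with N hN
  refine le_trans ?_ hs
  rw [show (∑' b : {x // x ∉ s}, a b) = ∑' b : ({x | x ∉ s} : Set ι), a b from rfl,
    tsum_subtype {x | x ∉ s} a]
  refine ENNReal.tsum_le_tsum fun i => ?_
  split_ifs with hi
  · have : i ∉ s := fun his => absurd (Finset.le_sup (f := h) his) (by omega)
    simp [this]
  · exact zero_le

/-- An additive error that can be made arbitrarily small can be dropped. -/
lemma le_of_forall_le_add_mul_ofReal {a b K : ℝ≥0∞} (hK : K ≠ ∞)
    (h : ∀ δ : ℝ, 0 < δ → a ≤ b + K * ENNReal.ofReal δ) : a ≤ b := by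
  have ht : Tendsto (fun δ : ℝ => b + K * ENNReal.ofReal δ) (𝓝[>] 0)
      (𝓝 (b + K * ENNReal.ofReal 0)) := by
    refine tendsto_const_nhds.add (ENNReal.Tendsto.const_mul ?_ (Or.inr hK))
    exact (ENNReal.continuous_ofReal.tendsto 0).mono_left nhdsWithin_le_nhds
  rw [ENNReal.ofReal_zero, mul_zero, add_zero] at ht
  exact ge_of_tendsto ht (by filter_upwards [self_mem_nhdsWithin] with δ hδ using h δ hδ)

lemma sobolevNorm_lt_ofReal_iff (G : WeightedGraph X) (m : X → ℝ) {p ε : ℝ}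
    (hp : 0 < p) (hε : 0 ≤ ε) {f : X → ℝ} :
    G.sobolevNorm m p f < ENNReal.ofReal ε ↔
      G.energy p f + lpMass m p f < ENNReal.ofReal (ε ^ p) := by
  rw [sobolevNorm, one_div, ENNReal.rpow_inv_lt_iff hp, ENNReal.ofReal_rpow_of_nonneg hε hp.le]

end Basic

/-! ### Spherically symmetric trees and the Hardy inequality for finitely supported functions -/

section Tree

variable {X : Type*} {G : WeightedGraph X} {o : X} {k : ℕ → ℕ}

lemma IsSphericallySymmetricTree.tsum_children (hG : G.IsSphericallySymmetricTree o k) (x : X) :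
    (∑' y : X, if G.toSimpleGraph.dist o y = G.toSimpleGraph.dist o x + 1
      then ENNReal.ofReal (G.b x y) else 0) = k (G.toSimpleGraph.dist o x) := by
  have h := hG.outDegree_eq x
  rw [outDegree] at h
  have h2 := ENNReal.ofReal_tsum_of_nonneg
    (f := fun y : {y : X // G.toSimpleGraph.dist o y = G.toSimpleGraph.dist o x + 1} => G.b x y)
    (fun y => G.nonneg _ _) ((G.summable x).subtype _)
  rw [h, ENNReal.ofReal_natCast] at h2
  rw [h2]
  exact tsum_ite_eq_tsum_subtype _ _

lemma IsSphericallySymmetricTree.tsum_parents (hG : G.IsSphericallySymmetricTree o k) {x : X}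
    (hx : x ≠ o) :
    (∑' y : X, if G.toSimpleGraph.dist o x = G.toSimpleGraph.dist o y + 1
      then ENNReal.ofReal (G.b x y) else 0) = 1 := by
  have h := hG.inDegree_eq x hx
  rw [inDegree] at h
  have h2 := ENNReal.ofReal_tsum_of_nonneg
    (f := fun y : {y : X // G.toSimpleGraph.dist o y + 1 = G.toSimpleGraph.dist o x} => G.b x y)
    (fun y => G.nonneg _ _) ((G.summable x).subtype _)
  rw [h, ENNReal.ofReal_one] at h2
  rw [h2]
  simp only [eq_comm (a := G.toSimpleGraph.dist o x)]
  exact tsum_ite_eq_tsum_subtype _ _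

lemma IsSphericallySymmetricTree.dist_eq_zero_iff (hG : G.IsSphericallySymmetricTree o k)
    {x : X} : G.toSimpleGraph.dist o x = 0 ↔ x = o := by
  rw [hG.isTree.connected.dist_eq_zero_iff, eq_comm]

lemma IsSphericallySymmetricTree.tsum_parents_le (hG : G.IsSphericallySymmetricTree o k) (x : X) :
    (∑' y : X, if G.toSimpleGraph.dist o x = G.toSimpleGraph.dist o y + 1
      then ENNReal.ofReal (G.b x y) else 0) ≤ 1 := by
  by_cases hx : x = o
  · simp [hG.dist_eq_zero_iff.2 hx]
  · exact (hG.tsum_parents hx).le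

lemma IsSphericallySymmetricTree.finite_sphere (hG : G.IsSphericallySymmetricTree o k) (n : ℕ) :
    {x | G.toSimpleGraph.dist o x = n}.Finite := by
  induction n with
  | zero =>
    refine (Set.finite_singleton o).subset fun x hx => ?_
    exact hG.dist_eq_zero_iff.1 hx
  | succ n ih =>
    have hfin : ∀ x, {y | G.b x y ≠ 0}.Finite := by
      intro x
      have h1 := (G.summable x).tendsto_cofinite_zero.eventually_lt_const one_pos
      rw [Filter.eventually_cofinite] at h1
      refine h1.subset fun y hy => ?_
      rcases hG.weight x y with h | h
      · exact absurd h hy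
      · simp [h]
    refine (ih.biUnion fun x _ => hfin x).subset fun y hy => ?_
    have hy' : G.toSimpleGraph.dist o y = n + 1 := hy
    have hyo : y ≠ o := fun h => by
      rw [hG.dist_eq_zero_iff.2 h] at hy'; omega
    have h1 : (∑' z : X, if G.toSimpleGraph.dist o y = G.toSimpleGraph.dist o z + 1
      then ENNReal.ofReal (G.b y z) else 0) ≠ 0 := by
      rw [hG.tsum_parents hyo]; exact one_ne_zero
    rw [Ne, ENNReal.tsum_eq_zero, not_forall] at h1
    obtain ⟨z, hz⟩ := h1
    split_ifs at hz with hd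
    · refine Set.mem_biUnion (x := z) (by rw [Set.mem_ofPred_eq]; omega) ?_
      intro hb
      rw [G.symm] at hb
      simp [hb] at hz
    · exact absurd rfl hz

lemma IsSphericallySymmetricTree.finite_ball (hG : G.IsSphericallySymmetricTree o k) (n : ℕ) :
    {x | G.toSimpleGraph.dist o x < n}.Finite := by
  refine ((Set.finite_Iio n).biUnion fun i _ => hG.finite_sphere i).subset fun x hx => ?_
  exact Set.mem_biUnion (Set.mem_Iio.2 hx) rfl

/-- Writing `|φ(x)|^p` as at most `2^(p-1) (|φ(x) - φ(y)|^p + |φ(y)|^p)` for each of the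
`k` children `y` of `x` and summing; every `y` occurs at most once, as it has at most
one parent. -/
lemma IsSphericallySymmetricTree.tsum_mul_branching_le (hG : G.IsSphericallySymmetricTree o k)
    {p : ℝ} (hp : 1 ≤ p) (φ : X → ℝ) :
    ∑' x, ENNReal.ofReal (|φ x| ^ p) * k (G.toSimpleGraph.dist o x) ≤
      (2 : ℝ≥0∞) ^ (p - 1) * (G.pairSum p φ + ∑' x, ENNReal.ofReal (|φ x| ^ p)) := by
  have key : ∑' x, ENNReal.ofReal (|φ x| ^ p) * k (G.toSimpleGraph.dist o x) ≤
      ∑' x, ∑' y, (2 : ℝ≥0∞) ^ (p - 1) *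
        (ENNReal.ofReal (G.b x y) * ENNReal.ofReal (|φ x - φ y| ^ p) +
          ENNReal.ofReal (|φ y| ^ p) *
            if G.toSimpleGraph.dist o y = G.toSimpleGraph.dist o x + 1
              then ENNReal.ofReal (G.b y x) else 0) := by
    refine ENNReal.tsum_le_tsum fun x => ?_
    rw [← hG.tsum_children x, ← ENNReal.tsum_mul_left]
    refine ENNReal.tsum_le_tsum fun y => ?_
    split_ifs with h
    · have h1 := ofReal_abs_add_rpow_le hp (φ x - φ y) (φ y)
      rw [sub_add_cancel] at h1
      calc _ ≤ _ := mul_le_mul_left h1 (ENNReal.ofReal (G.b x y))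
        _ = _ := by rw [G.symm y x]; ring
    · simp
  refine key.trans ?_
  simp only [ENNReal.tsum_mul_left, ENNReal.tsum_add]
  rw [← pairSum_eq_tsum, ENNReal.tsum_comm]
  simp only [ENNReal.tsum_mul_left]
  gcongr with y
  calc _ ≤ ENNReal.ofReal (|φ y| ^ p) * 1 := by
        gcongr
        exact hG.tsum_parents_le y
    _ = _ := mul_one _

/-- The Hardy inequality for finitely supported functions: where `k` exceeds `2^p`, the sum of
`|φ|^p` is absorbed into the left-hand side; there remains only a finite ball. -/
lemma IsSphericallySymmetricTree.hardy_of_finite_support (hG : G.IsSphericallySymmetricTree o k)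
    {p : ℝ} (hp : 1 ≤ p) {m : X → ℝ} {N : ℕ} {δ : ℝ} (hδ : 0 < δ)
    (hN : ∀ n, N ≤ n → (2 : ℝ≥0∞) * 2 ^ (p - 1) ≤ k n)
    (hm : ∀ x, G.toSimpleGraph.dist o x < N → δ ≤ m x)
    {φ : X → ℝ} (hφ : (Function.support φ).Finite) :
    ∑' x, ENNReal.ofReal (|φ x| ^ p) * k (G.toSimpleGraph.dist o x) ≤
      2 * 2 ^ (p - 1) * (G.pairSum p φ + (ENNReal.ofReal δ)⁻¹ * lpMass m p φ) := by
  set S := ∑' x, ENNReal.ofReal (|φ x| ^ p) * k (G.toSimpleGraph.dist o x) with hS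
  have hp0 : p ≠ 0 := by linarith
  have hδ0 : ENNReal.ofReal δ ≠ 0 := by simpa using hδ
  have hfin : S ≠ ∞ := by
    rw [hS, tsum_eq_sum (s := hφ.toFinset)]
    · exact ENNReal.sum_ne_top.2 fun x _ =>
        ENNReal.mul_ne_top ENNReal.ofReal_ne_top (ENNReal.natCast_ne_top _)
    · intro x hx
      have : φ x = 0 := by simpa using hx
      simp [this, Real.zero_rpow hp0]
  have h1 : (2 : ℝ≥0∞) ^ (p - 1) * ∑' x, ENNReal.ofReal (|φ x| ^ p) ≤
      2⁻¹ * S + 2 ^ (p - 1) * ((ENNReal.ofReal δ)⁻¹ * lpMass m p φ) := by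
    rw [lpMass_eq_tsum, hS]
    simp only [← ENNReal.tsum_mul_left, ← ENNReal.tsum_add]
    refine ENNReal.tsum_le_tsum fun x => ?_
    rcases le_or_gt N (G.toSimpleGraph.dist o x) with h | h
    · refine le_trans ?_ le_self_add
      rw [← ENNReal.inv_mul_le_iff (by simp) (by simp), inv_inv, ← mul_assoc, mul_comm]
      gcongr
      exact hN _ h
    · refine le_trans ?_ le_add_self
      rw [mul_left_comm (ENNReal.ofReal δ)⁻¹]
      gcongr
      refine le_mul_of_one_le_right' ?_
      rw [← ENNReal.inv_mul_cancel hδ0 ENNReal.ofReal_ne_top]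
      gcongr
      exact hm x h
  have h2 := hG.tsum_mul_branching_le hp φ
  rw [mul_add] at h2
  have h3 : S ≤ 2⁻¹ * S + 2 ^ (p - 1) * (G.pairSum p φ + (ENNReal.ofReal δ)⁻¹ * lpMass m p φ) := by
    calc S ≤ _ := h2
      _ ≤ _ := add_le_add le_rfl h1
      _ = _ := by ring
  have h4 : S = 2⁻¹ * S + 2⁻¹ * S := by
    rw [← add_mul, ENNReal.inv_two_add_inv_two, one_mul]
  have h5 : 2⁻¹ * S ≤ 2 ^ (p - 1) * (G.pairSum p φ + (ENNReal.ofReal δ)⁻¹ * lpMass m p φ) := by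
    refine (ENNReal.add_le_add_iff_left (ENNReal.mul_ne_top (by simp) hfin : 2⁻¹ * S ≠ ∞)).1 ?_
    rw [← h4]; exact h3
  rw [ENNReal.inv_mul_le_iff (by simp) (by simp)] at h5
  rw [mul_assoc]
  exact h5

end Tree

/-! ### The Hardy inequality on the closure, and cut-off functions -/

section Closure

variable {X : Type*} {G : WeightedGraph X} {o : X} {k : ℕ → ℕ}

/-- The Hardy inequality passes from finitely supported functions to `H_0^{1,p}`. The left-hand
side is not known to be small on `f - φ`, so it is first restricted to a finite set, where it is
controlled by the `ℓ^p(X,m)`-norm. -/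
lemma IsSphericallySymmetricTree.hardy_of_mem_sobolevZero
    (hG : G.IsSphericallySymmetricTree o k)
    {p : ℝ} (hp : 1 ≤ p) {m : X → ℝ} (hm0 : ∀ x, 0 < m x) {N : ℕ} {δ : ℝ} (hδ : 0 < δ)
    (hN : ∀ n, N ≤ n → (2 : ℝ≥0∞) * 2 ^ (p - 1) ≤ k n)
    (hm : ∀ x, G.toSimpleGraph.dist o x < N → δ ≤ m x)
    {f : X → ℝ} (hf : f ∈ G.sobolevZero m p) :
    ∑' x, ENNReal.ofReal (|f x| ^ p) * k (G.toSimpleGraph.dist o x) ≤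
      2 * (2 ^ (p - 1)) ^ 3 * (G.pairSum p f + (ENNReal.ofReal δ)⁻¹ * lpMass m p f) := by
  have hp0 : 0 < p := by linarith
  have hc := two_rpow_ne_top (p - 1)
  set c : ℝ≥0∞ := 2 ^ (p - 1)
  have hδ' : (ENNReal.ofReal δ)⁻¹ ≠ ∞ := by simpa using hδ
  refine ENNReal.summable.tsum_le_of_sum_le fun s => ?_
  set K : ℝ≥0∞ := ∑ x ∈ s, (k (G.toSimpleGraph.dist o x) : ℝ≥0∞) * (ENNReal.ofReal (m x))⁻¹
  have hK : K ≠ ∞ := ENNReal.sum_ne_top.2 fun x _ =>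
    ENNReal.mul_ne_top (ENNReal.natCast_ne_top _) (by simpa using hm0 x)
  refine le_of_forall_le_add_mul_ofReal
    (K := c * (2 * c * (c * ENNReal.ofReal p + (ENNReal.ofReal δ)⁻¹ * c) + K)) ?_ fun ε hε => ?_
  · have := ENNReal.ofReal_ne_top (r := p)
    finiteness
  obtain ⟨φ, hφ, hlt⟩ := hf.2 (ε ^ p⁻¹) (by positivity)
  rw [sobolevNorm_lt_ofReal_iff G m hp0 (by positivity),
    Real.rpow_inv_rpow hε.le hp0.ne'] at hlt
  have hE : G.pairSum p (f - φ) ≤ ENNReal.ofReal p * ENNReal.ofReal ε := by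
    rw [pairSum_eq_mul_energy G hp0]
    gcongr
    exact le_self_add.trans hlt.le
  have hM : lpMass m p (f - φ) ≤ ENNReal.ofReal ε := le_add_self.trans hlt.le
  have hEφ : G.pairSum p φ ≤ c * (G.pairSum p f + ENNReal.ofReal p * ENNReal.ofReal ε) := by
    have h := pairSum_add_le G hp f (φ - f)
    rw [add_sub_cancel] at h
    refine h.trans ?_
    gcongr
    refine le_trans (le_of_eq ?_) hE
    simp only [pairSum, Pi.sub_apply]
    refine tsum_congr fun x => tsum_congr fun y => ?_
    rw [← abs_neg]
    ring_nf
  have hMφ : lpMass m p φ ≤ c * (lpMass m p f + ENNReal.ofReal ε) := by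
    have h := lpMass_add_le m hp f (φ - f)
    rw [add_sub_cancel] at h
    refine h.trans ?_
    gcongr
    refine le_trans (le_of_eq ?_) hM
    simp only [lpMass, Pi.sub_apply]
    refine tsum_congr fun x => ?_
    rw [abs_sub_comm]
  have hS : ∑ x ∈ s, ENNReal.ofReal (|(f - φ) x| ^ p) * (k (G.toSimpleGraph.dist o x) : ℝ≥0∞) ≤
      K * ENNReal.ofReal ε := by
    rw [Finset.sum_mul]
    refine Finset.sum_le_sum fun x _ => ?_
    have h1 : ENNReal.ofReal (|(f - φ) x| ^ p) * ENNReal.ofReal (m x) ≤ ENNReal.ofReal ε := by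
      refine le_trans ?_ hM
      rw [lpMass_eq_tsum]
      exact ENNReal.le_tsum x
    rw [mul_comm, mul_assoc]
    gcongr
    rw [mul_comm, ← div_eq_mul_inv]
    exact (ENNReal.le_div_iff_mul_le (Or.inl (by simpa using hm0 x))
      (Or.inl ENNReal.ofReal_ne_top)).2 h1
  have hφ' := (ENNReal.sum_le_tsum s).trans (hG.hardy_of_finite_support hp hδ hN hm hφ)
  calc ∑ x ∈ s, ENNReal.ofReal (|f x| ^ p) * (k (G.toSimpleGraph.dist o x) : ℝ≥0∞)
      ≤ ∑ x ∈ s, c * (ENNReal.ofReal (|φ x| ^ p) * (k (G.toSimpleGraph.dist o x) : ℝ≥0∞) +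
          ENNReal.ofReal (|(f - φ) x| ^ p) * (k (G.toSimpleGraph.dist o x) : ℝ≥0∞)) := by
        refine Finset.sum_le_sum fun x _ => ?_
        rw [← add_mul, ← mul_assoc]
        gcongr
        have h := ofReal_abs_add_rpow_le hp (φ x) ((f - φ) x)
        rwa [Pi.sub_apply, add_sub_cancel] at h
    _ ≤ c * (2 * c * (c * (G.pairSum p f + ENNReal.ofReal p * ENNReal.ofReal ε) +
          (ENNReal.ofReal δ)⁻¹ * (c * (lpMass m p f + ENNReal.ofReal ε))) +
          K * ENNReal.ofReal ε) := by
        rw [← Finset.mul_sum, Finset.sum_add_distrib]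
        refine mul_le_mul_right (add_le_add (hφ'.trans ?_) hS) _
        gcongr
    _ = _ := by ring

/-- The radial profile that vanishes up to radius `N`, equals `1` from radius `2N` on and is
linear in between, for `N ≥ 1`. -/
noncomputable def ramp (N n : ℕ) : ℝ := max 0 (min 1 (((n : ℝ) - N) / N))

lemma ramp_nonneg (N n : ℕ) : 0 ≤ ramp N n := le_max_left _ _

lemma ramp_le_one (N n : ℕ) : ramp N n ≤ 1 := max_le zero_le_one (min_le_left _ _)

lemma ramp_of_le {N n : ℕ} (h : n ≤ N) : ramp N n = 0 := by
  have h' : (n : ℝ) ≤ N := by exact_mod_cast h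
  exact max_eq_left ((min_le_right _ _).trans
    (div_nonpos_of_nonpos_of_nonneg (by linarith) (by positivity)))

lemma ramp_of_ge {N n : ℕ} (hN : 1 ≤ N) (h : 2 * N ≤ n) : ramp N n = 1 := by
  have h' : 2 * (N : ℝ) ≤ n := by exact_mod_cast h
  have hN' : (0 : ℝ) < N := by exact_mod_cast hN
  have : 1 ≤ ((n : ℝ) - N) / N := by rw [le_div_iff₀ hN']; linarith
  rw [ramp, min_eq_left this, max_eq_right zero_le_one]

lemma abs_ramp_sub_ramp_le (N n n' : ℕ) :
    |ramp N n - ramp N n'| ≤ |(n : ℝ) - n'| / N := by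
  have h1 := abs_max_sub_max_le_abs (min 1 (((n : ℝ) - N) / N)) (min 1 (((n' : ℝ) - N) / N)) 0
  have h2 := abs_min_sub_min_le_max 1 (((n : ℝ) - N) / N) 1 (((n' : ℝ) - N) / N)
  rw [ramp, ramp, max_comm 0, max_comm 0]
  refine h1.trans (h2.trans ?_)
  rw [sub_self, abs_zero, max_eq_right (abs_nonneg _), ← sub_div, abs_div,
    sub_sub_sub_cancel_right, Nat.abs_cast]

/-- The slope `1/N` of the ramp is at most `2/n`, as the ramp is constant beyond radius `2N`. -/
lemma abs_ramp_sub_ramp_le_of_adj {N n n' : ℕ} (hN : 1 ≤ N) (h : n' = n + 1 ∨ n = n' + 1) :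
    |ramp N n - ramp N n'| ≤ if N ≤ n then 2 / (n : ℝ) else 0 := by
  have hN' : (0 : ℝ) < N := by exact_mod_cast hN
  split_ifs with hn
  · have hn' : (0 : ℝ) < n := by exact_mod_cast hN.trans hn
    rcases le_or_gt n (2 * N) with h2 | h2
    · refine (abs_ramp_sub_ramp_le N n n').trans ?_
      have h1 : |(n : ℝ) - n'| = 1 := by
        rcases h with rfl | rfl <;> push_cast <;> simp
      have h2' : (n : ℝ) ≤ 2 * N := by exact_mod_cast h2
      rw [h1, div_le_div_iff₀ hN' hn']
      linarith
    · rw [ramp_of_ge hN h2.le, ramp_of_ge hN (by omega), sub_self, abs_zero]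
      positivity
  · rw [ramp_of_le (by omega), ramp_of_le (by omega), sub_self, abs_zero]

/-- Energy of a function cut off inside the ball of radius `N`: by the product rule it is bounded
by a tail of the energy plus a tail of the weighted `ℓ^p`-sum, since a vertex at distance `n` has
at most `k n + 1` neighbours and the slope of the ramp is at most `2/n`. -/
lemma IsSphericallySymmetricTree.pairSum_mul_ramp_le (hG : G.IsSphericallySymmetricTree o k)
    {p γ D : ℝ} (hp : 1 ≤ p) (hk : ∀ n, 1 ≤ n → (k n : ℝ) ≤ D * (n : ℝ) ^ γ) {N : ℕ} (hN : 1 ≤ N)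
    (f : X → ℝ) :
    G.pairSum p (fun x => f x * ramp N (G.toSimpleGraph.dist o x)) ≤
      2 ^ (p - 1) *
        ((∑' q : X × X, if N ≤ G.toSimpleGraph.dist o q.2 then
            ENNReal.ofReal (G.b q.1 q.2 * |f q.1 - f q.2| ^ p) else 0) +
          ENNReal.ofReal (2 ^ p * (2 * D)) *
            ∑' x, if N ≤ G.toSimpleGraph.dist o x then
              (if G.toSimpleGraph.dist o x = 0 then 0 else ENNReal.ofReal (|f x| ^ p) *
                ENNReal.ofReal ((G.toSimpleGraph.dist o x : ℝ) ^ (γ - p))) else 0) := by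
  have hp0 : 0 ≤ p := by linarith
  set h := G.toSimpleGraph.dist o
  set ψ : X → ℝ := fun x => ramp N (h x) with hψ
  have hψ0 : ∀ x, 0 ≤ ψ x := fun x => ramp_nonneg _ _
  have hψ1 : ∀ x, ψ x ≤ 1 := fun x => ramp_le_one _ _
  have hsplit : ∀ x y, ENNReal.ofReal (G.b x y) * ENNReal.ofReal (|f x * ψ x - f y * ψ y| ^ p) ≤
      2 ^ (p - 1) * ((if N ≤ h y then ENNReal.ofReal (G.b x y * |f x - f y| ^ p) else 0) +
        ENNReal.ofReal (|f x| ^ p) * (if N ≤ h x then ENNReal.ofReal ((2 / (h x : ℝ)) ^ p) else 0) *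
          ((if h y = h x + 1 then ENNReal.ofReal (G.b x y) else 0) +
            if h x = h y + 1 then ENNReal.ofReal (G.b x y) else 0)) := by
    intro x y
    rcases (G.nonneg x y).eq_or_lt with h0 | hpos
    · rw [← h0]; simp
    have hstep := ofReal_abs_add_rpow_le hp ((f x - f y) * ψ y) (f x * (ψ x - ψ y))
    rw [show (f x - f y) * ψ y + f x * (ψ x - ψ y) = f x * ψ x - f y * ψ y by ring] at hstep
    refine (mul_le_mul_right hstep _).trans ?_
    rw [mul_left_comm, mul_add]
    refine mul_le_mul_right (add_le_add ?_ ?_) _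
    · split_ifs with hy
      · rw [ENNReal.ofReal_mul (G.nonneg _ _)]
        refine mul_le_mul_right (ENNReal.ofReal_le_ofReal
          (Real.rpow_le_rpow (abs_nonneg _) ?_ hp0)) _
        rw [abs_mul, abs_of_nonneg (hψ0 y)]
        exact mul_le_of_le_one_right (abs_nonneg _) (hψ1 y)
      · have : ψ y = 0 := ramp_of_le (by omega)
        simp [this, Real.zero_rpow (by linarith : p ≠ 0)]
    · have hadj : G.toSimpleGraph.Adj x y := hpos
      -- Neighbours at equal distance from the root do not contribute, whether or not they exist.
      by_cases heq : h y = h x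
      · have : ψ x - ψ y = 0 := by simp only [hψ, heq, sub_self]
        simp [this, Real.zero_rpow (by linarith : p ≠ 0)]
      have hd : h y = h x + 1 ∨ h x = h y + 1 := by
        have : h y = h x ∨ h y = h x + 1 ∨ h y = h x - 1 := hadj.diff_dist_adj
        omega
      have hb : ENNReal.ofReal (G.b x y) ≤ (if h y = h x + 1 then ENNReal.ofReal (G.b x y) else 0) +
            if h x = h y + 1 then ENNReal.ofReal (G.b x y) else 0 := by
        rcases hd with hd | hd
        · rw [if_pos hd]; exact le_self_add
        · rw [if_pos hd]; exact le_add_self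
      have hr := abs_ramp_sub_ramp_le_of_adj hN hd
      rw [abs_mul, Real.mul_rpow (abs_nonneg _) (abs_nonneg _),
        ENNReal.ofReal_mul (by positivity), mul_comm]
      refine mul_le_mul' (mul_le_mul_right ?_ _) hb
      refine (ENNReal.ofReal_le_ofReal (Real.rpow_le_rpow (abs_nonneg _) hr hp0)).trans ?_
      split_ifs
      · exact le_rfl
      · simp [Real.zero_rpow (by linarith : p ≠ 0)]
  have hvertex : ∀ x, ENNReal.ofReal (|f x| ^ p) *
      (if N ≤ h x then ENNReal.ofReal ((2 / (h x : ℝ)) ^ p) else 0) * ((k (h x) : ℝ≥0∞) + 1) ≤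
      ENNReal.ofReal (2 ^ p * (2 * D)) * if N ≤ h x then (if h x = 0 then 0 else
        ENNReal.ofReal (|f x| ^ p) * ENNReal.ofReal ((h x : ℝ) ^ (γ - p))) else 0 := by
    intro x
    split_ifs with h1 h2
    · omega
    · -- Children contribute `k` and parents at most `1`, and `k + 1 ≤ 2 k`.
      have hx1 : 1 ≤ h x := by omega
      have hx : (0 : ℝ) < h x := by exact_mod_cast hx1
      have hk1 : (1 : ℝ) ≤ k (h x) := by exact_mod_cast hG.branching_pos (h x)
      have hkx := hk _ hx1
      rw [mul_left_comm, mul_assoc]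
      refine mul_le_mul_right ?_ _
      have hD : 0 ≤ D := by
        by_contra hneg
        have : D * (h x : ℝ) ^ γ ≤ 0 :=
          mul_nonpos_of_nonpos_of_nonneg (by linarith) (by positivity)
        linarith
      rw [← ENNReal.ofReal_natCast, ← ENNReal.ofReal_one, ← ENNReal.ofReal_add (by positivity)
        zero_le_one, ← ENNReal.ofReal_mul (by positivity), ← ENNReal.ofReal_mul (by positivity)]
      refine ENNReal.ofReal_le_ofReal ?_
      rw [Real.div_rpow (by norm_num) hx.le, Real.rpow_sub hx]
      calc (2 : ℝ) ^ p / (h x : ℝ) ^ p * (k (h x) + 1)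
          ≤ (2 : ℝ) ^ p / (h x : ℝ) ^ p * (2 * (D * (h x : ℝ) ^ γ)) := by
            gcongr
            linarith
        _ = _ := by ring
    · simp
  rw [pairSum_eq_tsum]
  calc _ ≤ _ := ENNReal.tsum_le_tsum fun x => ENNReal.tsum_le_tsum fun y => hsplit x y
    _ ≤ _ := by
      simp only [ENNReal.tsum_mul_left, ENNReal.tsum_add]
      refine mul_le_mul_right (add_le_add ?_ ?_) _
      · exact (ENNReal.tsum_prod (f := fun x y =>
          if N ≤ h y then ENNReal.ofReal (G.b x y * |f x - f y| ^ p) else 0)).ge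
      · rw [← ENNReal.tsum_mul_left]
        refine ENNReal.tsum_le_tsum fun x => le_trans ?_ (hvertex x)
        refine mul_le_mul_right (add_le_add ?_ ?_) _
        · exact (hG.tsum_children x).le
        · exact hG.tsum_parents_le x

/-- Cut-off criterion: the functions `f (1 - ramp N)` are finitely supported and converge to `f`
as soon as `∑ A|f|^p(n) n^(γ - p)` is finite. -/
lemma IsSphericallySymmetricTree.mem_sobolevZero_of_radialSum
    (hG : G.IsSphericallySymmetricTree o k)
    {p γ D : ℝ} (hp : 1 ≤ p) (hk : ∀ n, 1 ≤ n → (k n : ℝ) ≤ D * (n : ℝ) ^ γ)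
    {m : X → ℝ} {f : X → ℝ} (hf : f ∈ G.sobolev m p) (hr : G.radialSum o p (γ - p) f < ∞) :
    f ∈ G.sobolevZero m p := by
  have hp0 : 0 < p := by linarith
  have hc := two_rpow_ne_top (p - 1)
  refine ⟨hf, fun ε hε => ?_⟩
  have hE : (∑' q : X × X, ENNReal.ofReal (G.b q.1 q.2 * |f q.1 - f q.2| ^ p)) ≠ ∞ := by
    rw [ENNReal.tsum_prod (f := fun x y => ENNReal.ofReal (G.b x y * |f x - f y| ^ p))]
    exact hf.1.ne
  have t1 := tendsto_tsum_tail hE (fun q => G.toSimpleGraph.dist o q.2)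
  have hr' := hr.ne
  rw [radialSum_eq_tsum] at hr'
  have t2 := tendsto_tsum_tail hr' (G.toSimpleGraph.dist o)
  have hM := hf.2.ne
  rw [lpMass_eq_tsum] at hM
  have t3 := tendsto_tsum_tail hM (G.toSimpleGraph.dist o)
  have t4 := (ENNReal.Tendsto.const_mul (ENNReal.Tendsto.const_mul
    (t1.add (ENNReal.Tendsto.const_mul t2
      (Or.inr (ENNReal.ofReal_ne_top (r := 2 ^ p * (2 * D)))))) (Or.inr hc))
    (Or.inr (ENNReal.ofReal_ne_top (r := 1 / p)))).add t3
  simp only [mul_zero, add_zero] at t4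
  have hεp : (0 : ℝ≥0∞) < ENNReal.ofReal (ε ^ p) := by
    rw [ENNReal.ofReal_pos]; positivity
  obtain ⟨N, hN, hN1⟩ := ((t4.eventually_lt_const hεp).and (eventually_ge_atTop 1)).exists
  refine ⟨fun x => f x * (1 - ramp N (G.toSimpleGraph.dist o x)), ?_, ?_⟩
  · refine (hG.finite_ball (2 * N)).subset fun x hx => ?_
    by_contra hlt
    refine hx ?_
    simp only
    rw [ramp_of_ge hN1 (not_lt.1 hlt), sub_self, mul_zero]
  · have hdiff : (f - fun x => f x * (1 - ramp N (G.toSimpleGraph.dist o x))) =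
        fun x => f x * ramp N (G.toSimpleGraph.dist o x) := by
      funext x
      simp only [Pi.sub_apply]
      ring
    rw [hdiff, sobolevNorm_lt_ofReal_iff G m hp0 hε.le]
    refine lt_of_le_of_lt (add_le_add ?_ ?_) hN
    · exact mul_le_mul_right (hG.pairSum_mul_ramp_le hp hk hN1 f) _
    · rw [lpMass_eq_tsum]
      refine ENNReal.tsum_le_tsum fun x => ?_
      split_ifs with hx
      · refine mul_le_mul_left (ENNReal.ofReal_le_ofReal
          (Real.rpow_le_rpow (abs_nonneg _) ?_ hp0.le)) _
        rw [abs_mul, abs_of_nonneg (ramp_nonneg _ _)]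
        exact mul_le_of_le_one_right (abs_nonneg _) (ramp_le_one _ _)
      · simp [ramp_of_le (not_le.1 hx).le, Real.zero_rpow hp0.ne']

end Closure

/-! ### Comparison of radial sums with weighted sums over vertices -/

section Comparison

variable {X : Type*} {G : WeightedGraph X} {o : X} {k : ℕ → ℕ}

lemma radialSum_mono_exponent {p s t : ℝ} (hst : s ≤ t) (f : X → ℝ) :
    G.radialSum o p s f ≤ G.radialSum o p t f := by
  refine ENNReal.tsum_le_tsum fun n => ?_
  gcongr
  simp

lemma radialSum_le_mul_tsum {p s D : ℝ} {w : X → ℝ≥0∞}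
    (hw : ∀ x, 1 ≤ G.toSimpleGraph.dist o x →
      ENNReal.ofReal ((G.toSimpleGraph.dist o x : ℝ) ^ s) ≤ ENNReal.ofReal D * w x) (f : X → ℝ) :
    G.radialSum o p s f ≤ ENNReal.ofReal D * ∑' x, ENNReal.ofReal (|f x| ^ p) * w x := by
  rw [radialSum_eq_tsum, ← ENNReal.tsum_mul_left]
  refine ENNReal.tsum_le_tsum fun x => ?_
  split_ifs with h
  · exact zero_le
  · rw [mul_left_comm]
    gcongr
    exact hw x (by omega)

lemma IsSphericallySymmetricTree.lpMass_le (hG : G.IsSphericallySymmetricTree o k)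
    {p η D : ℝ} (hD : 0 ≤ D) {m : X → ℝ}
    (hm : ∀ x, 1 ≤ G.toSimpleGraph.dist o x → m x ≤ D * (G.toSimpleGraph.dist o x : ℝ) ^ η)
    (f : X → ℝ) :
    lpMass m p f ≤
      ENNReal.ofReal D * G.radialSum o p η f + ENNReal.ofReal (|f o| ^ p * m o) := by
  classical
  rw [radialSum_eq_tsum, ← ENNReal.tsum_mul_left, lpMass,
    ← tsum_ite_eq o (fun x => ENNReal.ofReal (|f x| ^ p * m x)), ← ENNReal.tsum_add]
  refine ENNReal.tsum_le_tsum fun x => ?_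
  by_cases hx : x = o
  · rw [if_pos hx]
    exact le_add_self
  · have h0 : G.toSimpleGraph.dist o x ≠ 0 := fun h => hx (hG.dist_eq_zero_iff.1 h)
    rw [if_neg hx, if_neg h0, add_zero, ENNReal.ofReal_mul (by positivity), mul_left_comm,
      ← ENNReal.ofReal_mul hD]
    gcongr
    exact hm x (by omega)

end Comparison

end WeightedGraph

open WeightedGraph Filter in
theorem mainTheorem12 {X : Type*} [Countable X] (G : WeightedGraph X) (o : X)
    (k : ℕ → ℕ) (hG : G.IsSphericallySymmetricTree o k)
    (m : X → ℝ) (hm : ∀ x, 0 < m x)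
    (μ : ℕ → ℝ) (hμ : ∀ x, m x = μ (G.toSimpleGraph.dist o x))
    (p γ η : ℝ) (hp : 1 < p) (hγ : 0 < γ) (hη : η < 0)
    (hk_mono : Monotone k) (hk : AsympFrom 1 (fun n => (k n : ℝ)) (fun n => (n : ℝ) ^ γ))
    (hμ_anti : Antitone μ) (hμ_asymp : AsympFrom 1 μ (fun n => (n : ℝ) ^ η)) :
    (γ ≤ η + p → G.sobolev m p = G.sobolevZero m p) ∧
    (η + p < γ →
      (∃ C : ℝ, 0 < C ∧ ∀ f ∈ G.sobolevZero m p,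
        ENNReal.ofReal C * G.radialSum o p (γ - p) f ≤
          G.energy p f + G.radialSum o p η f + ENNReal.ofReal (|f o| ^ p * m o)) ∧
      (∀ f : X → ℝ, f ∈ G.sobolevZero m p ↔
        f ∈ G.finiteEnergy p ∧ G.radialSum o p (γ - p) f < ∞)) := by
  have hp0 : 0 < p := by linarith
  obtain ⟨C₁, D₁, hC₁, hD₁, hk⟩ := hk
  obtain ⟨C₂, D₂, hC₂, hD₂, hμa⟩ := hμ_asymp
  have hk_le : ∀ n, 1 ≤ n → (k n : ℝ) ≤ C₁⁻¹ * (n : ℝ) ^ γ := fun n hn => by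
    rw [le_inv_mul_iff₀ hC₁]; exact (hk n hn).1
  have hm_le : ∀ x, 1 ≤ G.toSimpleGraph.dist o x →
      m x ≤ C₂⁻¹ * (G.toSimpleGraph.dist o x : ℝ) ^ η := fun x hx => by
    rw [le_inv_mul_iff₀ hC₂, hμ]; exact (hμa _ hx).1
  have hC₂' : 0 ≤ C₂⁻¹ := by positivity
  refine ⟨fun hle => Set.Subset.antisymm (fun f hf => ?_) fun f hf => hf.1, fun hlt => ?_⟩
  · refine hG.mem_sobolevZero_of_radialSum hp.le hk_le hf ?_
    refine (radialSum_mono_exponent (by linarith : γ - p ≤ η) f).trans_lt ?_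
    refine (radialSum_le_mul_tsum (D := D₂) (w := fun x => ENNReal.ofReal (m x))
      (fun x hx => ?_) f).trans_lt ?_
    · rw [← ENNReal.ofReal_mul hD₂.le, hμ]
      exact ENNReal.ofReal_le_ofReal (hμa _ hx).2
    · rw [← lpMass_eq_tsum]
      exact ENNReal.mul_lt_top ENNReal.ofReal_lt_top hf.2
  -- Beyond radius `N` the branching numbers exceed `2^p`.
  obtain ⟨N, hN1, hN⟩ : ∃ N : ℕ, 1 ≤ N ∧
      ∀ n, N ≤ n → (2 : ENNReal) * 2 ^ (p - 1) ≤ (k n : ENNReal) := by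
    have ht : Tendsto (fun n : ℕ => (n : ℝ) ^ γ) atTop atTop :=
      (tendsto_rpow_atTop hγ).comp tendsto_natCast_atTop_atTop
    obtain ⟨N, hN, hN1⟩ := ((ht.eventually_ge_atTop (D₁ * (2 * 2 ^ (p - 1)))).and
      (eventually_ge_atTop 1)).exists
    refine ⟨N, hN1, fun n hn => ?_⟩
    have h1 : (2 : ℝ) * 2 ^ (p - 1) ≤ k N :=
      le_of_mul_le_mul_left (hN.trans (hk N hN1).2) hD₁
    have h2 : (2 : ENNReal) * 2 ^ (p - 1) = ENNReal.ofReal (2 * 2 ^ (p - 1)) := by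
      rw [ENNReal.ofReal_mul (by norm_num), ← ENNReal.ofReal_rpow_of_pos (by norm_num),
        ENNReal.ofReal_ofNat]
    rw [h2, ← ENNReal.ofReal_natCast]
    exact ENNReal.ofReal_le_ofReal (h1.trans (by exact_mod_cast hk_mono hn))
  have hμN : 0 < μ N := by
    have h1 : (0 : ℝ) < (N : ℝ) ^ η := Real.rpow_pos_of_pos (by exact_mod_cast hN1) _
    exact pos_of_mul_pos_right (h1.trans_le (hμa N hN1).2) hD₂.le
  have hmN : ∀ x, G.toSimpleGraph.dist o x < N → μ N ≤ m x := fun x hx => by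
    rw [hμ]; exact hμ_anti hx.le
  have hhardy : ∃ M : ENNReal, M ≠ ⊤ ∧ ∀ f ∈ G.sobolevZero m p, G.radialSum o p (γ - p) f ≤
      M * (G.energy p f + G.radialSum o p η f + ENNReal.ofReal (|f o| ^ p * m o)) := by
    have hc := two_rpow_ne_top (p - 1)
    have hμ' : (ENNReal.ofReal (μ N))⁻¹ ≠ ⊤ := by simpa using hμN
    refine ⟨ENNReal.ofReal D₁ * (2 * (2 ^ (p - 1)) ^ 3 * (ENNReal.ofReal p +
      (ENNReal.ofReal (μ N))⁻¹ * (ENNReal.ofReal C₂⁻¹ + 1))), by finiteness, fun f hf => ?_⟩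
    refine (radialSum_le_mul_tsum (D := D₁)
      (w := fun x => (k (G.toSimpleGraph.dist o x) : ENNReal)) (fun x hx => ?_) f).trans ?_
    · rw [← ENNReal.ofReal_natCast, ← ENNReal.ofReal_mul hD₁.le]
      refine ENNReal.ofReal_le_ofReal (le_trans ?_ (hk _ hx).2)
      exact Real.rpow_le_rpow_of_exponent_le (by exact_mod_cast hx) (by linarith)
    rw [mul_assoc, mul_assoc (2 * _)]
    refine mul_le_mul_right ((hG.hardy_of_mem_sobolevZero hp.le hm hμN hN hmN hf).trans ?_) _
    refine mul_le_mul_right ?_ _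
    rw [add_mul, pairSum_eq_mul_energy G hp0, mul_assoc (ENNReal.ofReal (μ N))⁻¹]
    refine add_le_add (mul_le_mul_right (le_self_add.trans le_self_add) _)
      (mul_le_mul_right ((hG.lpMass_le hC₂' hm_le f).trans ?_) _)
    rw [add_mul, one_mul]
    exact add_le_add (mul_le_mul_right (le_add_self.trans le_self_add) _) le_add_self
  obtain ⟨M, hM, hhardy⟩ := hhardy
  refine ⟨⟨(M.toReal + 1)⁻¹, by positivity, fun f hf => ?_⟩, fun f => ⟨fun hf => ⟨hf.1.1, ?_⟩, ?_⟩⟩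
  · rw [ENNReal.ofReal_inv_of_pos (by positivity), ENNReal.inv_mul_le_iff
      (by simp only [ne_eq, ENNReal.ofReal_eq_zero, not_le]; positivity) ENNReal.ofReal_ne_top]
    refine (hhardy f hf).trans (mul_le_mul_left ?_ _)
    rw [ENNReal.ofReal_add ENNReal.toReal_nonneg zero_le_one, ENNReal.ofReal_toReal hM]
    exact le_self_add
  · refine (hhardy f hf).trans_lt (ENNReal.mul_lt_top hM.lt_top ?_)
    have h1 : G.radialSum o p η f < ⊤ := by
      refine (radialSum_le_mul_tsum (D := D₂) (w := fun x => ENNReal.ofReal (m x))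
        (fun x hx => ?_) f).trans_lt ?_
      · rw [← ENNReal.ofReal_mul hD₂.le, hμ]
        exact ENNReal.ofReal_le_ofReal (hμa _ hx).2
      · rw [← lpMass_eq_tsum]
        exact ENNReal.mul_lt_top ENNReal.ofReal_lt_top hf.1.2
    have h2 : G.energy p f < ⊤ := ENNReal.mul_lt_top ENNReal.ofReal_lt_top hf.1.1
    exact ENNReal.add_lt_top.2 ⟨ENNReal.add_lt_top.2 ⟨h2, h1⟩, ENNReal.ofReal_lt_top⟩
  · rintro ⟨hfE, hfr⟩
    refine hG.mem_sobolevZero_of_radialSum hp.le hk_le ⟨hfE, ?_⟩ hfr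
    refine (hG.lpMass_le hC₂' hm_le f).trans_lt (ENNReal.add_lt_top.2
      ⟨ENNReal.mul_lt_top ENNReal.ofReal_lt_top ?_, ENNReal.ofReal_lt_top⟩)
    exact (radialSum_mono_exponent (by linarith : η ≤ γ - p) f).trans_lt hfr
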